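/- Definitions. A \emph{GBS group} is a group $G$ that acts without inversions on a simplicial tree such that all vertex and edge stabilizers are infinite cyclic; such a tree is a \emph{GBS tree} for $G$. $G$ is \emph{non-elementary} if it has a GBS tree without an invariant point or invariant line (this does not depend on the GBS tree). An element or subgroup of $G$ is \emph{elliptic} if it fixes a vertex of a GBS tree; for non-elementary $G$ this does not depend on the tree. The \emph{modular homomorphism} $q\colon G\to\mathbb{Q}^\times$ is defined by fixing a non-trivial elliptic element $a$ and setting $q(g)=m/n$ where $m,n$ are non-zero integers with $g^{-1}a^mg=a^n$; for non-elementary $G$ it is independent of $a$. For a non-trivial elliptic subgroup $V<G$, put $V^g=gVg^{-1}$, let $D_V(g)=[V:V\cap V^g]$ be the \emph{$V$-depth} of $g\in G$, and let the \emph{depth profile} be \[\mathcal{D}(G,V)=\{D_V(g)\mid g\in G,\ q(g)=\pm1\}.\] For $S\subset\mathbb{N}=\{1,2,\dots\}$ and $r\in\mathbb{N}$ let $S/r=\{n/\gcd(r,n)\mid n\in S\}$, and let $\sim$ be the smallest equivalence relation on subsets of $\mathbb{N}$ with $S\sim S/r$ for all $S$ and all $r\in\mathbb{N}$. Two groups are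 (abstractly) commensurable if they have isomorphic subgroups of finite index. Theorem. Let $G$ be a non-elementary GBS group and $V<G$ a non-trivial elliptic subgroup. Then all the $V$-depths $D_V(g)$, $g\in G$, are finite, so that $\mathcal{D}(G,V)\subset\mathbb{N}$, and: \begin{enumerate} \item If $G'<G$ is a subgroup of finite index and $V\subset G'$, then $G'$ is a non-elementary GBS group, $V$ is an elliptic subgroup of $G'$, and $\mathcal{D}(G,V)=\mathcal{D}(G',V)$. \item If $V'<V$ with $[V:V']=r<\infty$, then $\mathcal{D}(G,V')=\{\,n/\gcd(r,n)\mid n\in\mathcal{D}(G,V)\,\}$. \item The equivalence class of the depth profile is a commensurability invariant: if $H$ is a non-elementary GBS group commensurable with $G$ and $W<H$ is a non-trivial elliptic subgroup, then $\mathcal{D}(G,V)\sim\mathcal{D}(H,W)$. \end{enumerate} -/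

import Mathlib

universe u v

/-- A GBS tree for `G`: a simplicial tree on which `G` acts by simplicial automorphisms, without
inversions, such that all vertex stabilizers and all edge stabilizers are infinite cyclic. -/
structure GBSTree (G : Type u) [Group G] where
  /-- The vertex set. -/
  Vert : Type u
  /-- The underlying simplicial tree (connected, in particular non-empty, and acyclic). -/
  graph : SimpleGraph Vert
  isTree : graph.IsTree
  /-- The action on the vertices. -/
  act : MulAction G Vert
  adj_smul : ∀ (g : G) (x y : Vert), graph.Adj x y → graph.Adj (g • x) (g • y)
  no_inversion : ∀ (g : G) (x y : Vert), graph.Adj x y → ¬ (g • x = y ∧ g • y = x)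
  vertex_stabilizer : ∀ x : Vert, Nonempty (MulAction.stabilizer G x ≃* Multiplicative ℤ)
  edge_stabilizer : ∀ x y : Vert, graph.Adj x y →
    Nonempty (↥(MulAction.stabilizer G x ⊓ MulAction.stabilizer G y) ≃* Multiplicative ℤ)

attribute [instance] GBSTree.act

/-- A tree is elementary if there is an invariant point or an invariant line. As there are no
inversions, an invariant point of the geometric realization exists if and only if there is a
fixed vertex. A line is an embedded copy of the simplicial line with vertex set `ℤ`. -/
def GBSTree.IsElementary {G : Type u} [Group G] (X : GBSTree G) : Prop :=
  (∃ x : X.Vert, ∀ g : G, g • x = x) ∨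
  (∃ l : ℤ → X.Vert, Function.Injective l ∧ (∀ i, X.graph.Adj (l i) (l (i + 1))) ∧
    ∀ (g : G) (i : ℤ), g • l i ∈ Set.range l)

/-- `G` is a non-elementary generalized Baumslag--Solitar group. (Being non-elementary does not
depend on the GBS tree. Trees in the universe of `G` suffice, because the subtree spanned by one
orbit is again a GBS tree.) -/
def IsNonelementaryGBS (G : Type u) [Group G] : Prop :=
  ∃ X : GBSTree G, ¬ X.IsElementary

/-- A subgroup is elliptic if it fixes a vertex of a GBS tree. (For a non-elementary GBS group all
GBS trees have the same elliptic subgroups.) -/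
def IsEllipticSubgroup {G : Type u} [Group G] (V : Subgroup G) : Prop :=
  ∃ (X : GBSTree G) (x : X.Vert), ∀ g ∈ V, g • x = x

/-- An element is elliptic if it fixes a vertex of a GBS tree. -/
def IsElliptic {G : Type u} [Group G] (a : G) : Prop :=
  ∃ (X : GBSTree G) (x : X.Vert), a • x = x

section Modular

variable {G : Type u} [Group G]

/-- `t = m / n` for some non-zero integers with `g⁻¹ a ^ m g = a ^ n`. -/
def IsModulus (a g : G) (t : ℚ) : Prop :=
  ∃ m n : ℤ, m ≠ 0 ∧ n ≠ 0 ∧ g⁻¹ * a ^ m * g = a ^ n ∧ t = m / n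

theorem conj_zpow_aux (g b : G) (k : ℤ) : (g⁻¹ * b * g) ^ k = g⁻¹ * b ^ k * g := by
  have h := conj_zpow (a := g⁻¹) (b := b) (i := k)
  simpa using h

theorem IsModulus.unique {a g : G} (ha : Function.Injective (fun k : ℤ => a ^ k)) {s t : ℚ}
    (hs : IsModulus a g s) (ht : IsModulus a g t) : s = t := by
  obtain ⟨m, n, hm, hn, h, rfl⟩ := hs
  obtain ⟨p, q, hp, hq, h', rfl⟩ := ht
  have h1 : a ^ (n * p) = a ^ (q * m) := by
    rw [zpow_mul, zpow_mul, ← h, ← h', conj_zpow_aux, conj_zpow_aux, ← zpow_mul, ← zpow_mul,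
      mul_comm m p]
  have h2 : n * p = q * m := ha h1
  have hn' : (n : ℚ) ≠ 0 := by exact_mod_cast hn
  have hq' : (q : ℚ) ≠ 0 := by exact_mod_cast hq
  rw [div_eq_div_iff hn' hq']
  have h3 : (n : ℚ) * p = q * m := by exact_mod_cast h2
  linarith

theorem IsModulus.mul {a g h : G} {s t : ℚ} (hs : IsModulus a g s) (ht : IsModulus a h t) :
    IsModulus a (g * h) (s * t) := by
  obtain ⟨m, n, hm, hn, e, rfl⟩ := hs
  obtain ⟨p, q, hp, hq, e', rfl⟩ := ht
  refine ⟨m * p, n * q, mul_ne_zero hm hp, mul_ne_zero hn hq, ?_, ?_⟩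
  · have h1 : g⁻¹ * a ^ (m * p) * g = a ^ (n * p) := by
      rw [zpow_mul, ← conj_zpow_aux, e, ← zpow_mul]
    have h2 : h⁻¹ * a ^ (n * p) * h = a ^ (n * q) := by
      rw [mul_comm n p, zpow_mul, ← conj_zpow_aux, e', ← zpow_mul, mul_comm]
    rw [← h2, ← h1]
    group
  · push_cast
    rw [div_mul_div_comm]

theorem IsModulus.one (a : G) : IsModulus a 1 1 :=
  ⟨1, 1, one_ne_zero, one_ne_zero, by simp, by simp⟩

theorem IsModulus.ne_zero {a g : G} {t : ℚ} (ht : IsModulus a g t) : t ≠ 0 := by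
  obtain ⟨m, n, hm, hn, -, rfl⟩ := ht
  exact div_ne_zero (by exact_mod_cast hm) (by exact_mod_cast hn)

/-- The homomorphism `g ↦ m / n`, where `g⁻¹ a ^ m g = a ^ n`. -/
noncomputable def modularHomOf (a : G) (ha : Function.Injective (fun k : ℤ => a ^ k))
    (h : ∀ g : G, ∃ t : ℚ, IsModulus a g t) : G →* ℚˣ where
  toFun g := Units.mk0 (h g).choose (h g).choose_spec.ne_zero
  map_one' := Units.ext ((h 1).choose_spec.unique ha (IsModulus.one a))
  map_mul' g g' := Units.ext
    ((h (g * g')).choose_spec.unique ha ((h g).choose_spec.mul (h g').choose_spec))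

theorem GBSTree.zpow_injective (X : GBSTree G) {x : X.Vert} {a : G} (hx : a • x = x)
    (ha : a ≠ 1) : Function.Injective (fun k : ℤ => a ^ k) := by
  obtain ⟨e⟩ := X.vertex_stabilizer x
  intro k l hkl
  have h1 : (⟨a, hx⟩ : MulAction.stabilizer G x) ^ k = ⟨a, hx⟩ ^ l := Subtype.ext hkl
  have h2 := congrArg (fun z => (e z).toAdd) h1
  simp only [map_zpow, toAdd_zpow, smul_eq_mul] at h2
  refine mul_right_cancel₀ ?_ h2
  intro h0
  apply ha
  have h3 : (⟨a, hx⟩ : MulAction.stabilizer G x) = 1 := e.injective (by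
    rw [map_one]; exact h0)
  exact congrArg Subtype.val h3

theorem GBSTree.exists_generator (X : GBSTree G) (x : X.Vert) :
    ∃ c : G, c • x = x ∧ ∀ a : G, a • x = x → ∃ i : ℤ, a = c ^ i := by
  obtain ⟨e⟩ := X.vertex_stabilizer x
  refine ⟨e.symm (Multiplicative.ofAdd 1), (e.symm (Multiplicative.ofAdd 1)).2, fun a ha => ?_⟩
  refine ⟨(e ⟨a, ha⟩).toAdd, ?_⟩
  have h : (⟨a, ha⟩ : MulAction.stabilizer G x) =
      (e.symm (Multiplicative.ofAdd 1)) ^ (e ⟨a, ha⟩).toAdd := by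
    apply e.injective
    rw [map_zpow, e.apply_symm_apply]
    apply Multiplicative.toAdd.injective
    simp
  exact congrArg Subtype.val h

theorem GBSTree.exists_zpow_of_adj (X : GBSTree G) {x y : X.Vert} (hxy : X.graph.Adj x y)
    {a : G} (hx : a • x = x) : ∃ k : ℤ, k ≠ 0 ∧ (a ^ k) • y = y := by
  obtain ⟨c, -, hc⟩ := X.exists_generator x
  obtain ⟨e⟩ := X.edge_stabilizer x y hxy
  set b := e.symm (Multiplicative.ofAdd 1) with hb
  obtain ⟨j, hj⟩ := hc b b.2.1
  obtain ⟨i, rfl⟩ := hc a hx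
  refine ⟨j, ?_, ?_⟩
  · rintro rfl
    have h1 : b = 1 := Subtype.ext (by simpa using hj)
    rw [h1] at hb
    have h2 := congrArg e hb
    rw [map_one, e.apply_symm_apply] at h2
    exact absurd (congrArg Multiplicative.toAdd h2) (by simp)
  · rw [← zpow_mul, mul_comm, zpow_mul, ← hj]
    exact (MulAction.stabilizer G y).zpow_mem b.2.2 i

theorem GBSTree.exists_zpow (X : GBSTree G) (x y : X.Vert) {a : G} (hx : a • x = x) :
    ∃ k : ℤ, k ≠ 0 ∧ (a ^ k) • y = y := by
  obtain ⟨w⟩ := X.isTree.connected.preconnected x y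
  induction w generalizing a with
  | nil => exact ⟨1, one_ne_zero, by simpa using hx⟩
  | cons h w ih =>
    obtain ⟨k, hk, hk'⟩ := X.exists_zpow_of_adj h hx
    obtain ⟨l, hl, hl'⟩ := ih hk'
    exact ⟨k * l, mul_ne_zero hk hl, by rw [zpow_mul]; exact hl'⟩

theorem GBSTree.exists_isModulus (X : GBSTree G) {x : X.Vert} {a : G} (hx : a • x = x)
    (ha : a ≠ 1) (g : G) : ∃ t : ℚ, IsModulus a g t := by
  obtain ⟨c, -, hc⟩ := X.exists_generator x
  obtain ⟨k, hk, hk'⟩ := X.exists_zpow x (g • x) hx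
  have hinj := X.zpow_injective hx ha
  have h1 : (g⁻¹ * a ^ k * g) • x = x := by
    rw [mul_smul, mul_smul, hk', inv_smul_smul]
  obtain ⟨j, hj⟩ := hc _ h1
  obtain ⟨i, hi⟩ := hc a hx
  have hi0 : i ≠ 0 := by
    rintro rfl
    exact ha (by simpa using hi)
  have hj0 : j ≠ 0 := by
    rintro rfl
    have h2 : a ^ k = 1 := by
      have h3 : a ^ k = g * (g⁻¹ * a ^ k * g) * g⁻¹ := by group
      rw [h3, hj]; simp
    exact hk (hinj (by simpa using h2))
  refine ⟨_, k * i, j, mul_ne_zero hk hi0, hj0, ?_, rfl⟩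
  rw [zpow_mul, ← conj_zpow_aux, hj, ← zpow_mul, mul_comm, zpow_mul, ← hi]

theorem IsElliptic.zpow_injective {a : G} (h : IsElliptic a) (ha : a ≠ 1) :
    Function.Injective (fun k : ℤ => a ^ k) := by
  obtain ⟨X, x, hx⟩ := h
  exact X.zpow_injective hx ha

theorem IsElliptic.exists_isModulus {a : G} (h : IsElliptic a) (ha : a ≠ 1) (g : G) :
    ∃ t : ℚ, IsModulus a g t := by
  obtain ⟨X, x, hx⟩ := h
  exact X.exists_isModulus hx ha g

end Modular

open Classical in
/-- The modular homomorphism `q : G → ℚˣ` of a GBS group: fix a non-trivial elliptic element `a`;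
then `q g = m / n`, where `g⁻¹ a ^ m g = a ^ n` with `m, n` non-zero. (For a non-elementary GBS
group the choice of `a` is irrelevant. Every GBS group has such an `a`; for other groups the value
is the trivial homomorphism.) -/
noncomputable def modularHom (G : Type u) [Group G] : G →* ℚˣ :=
  if h : ∃ a : G, IsElliptic a ∧ a ≠ 1 then
    modularHomOf h.choose (h.choose_spec.1.zpow_injective h.choose_spec.2)
      (h.choose_spec.1.exists_isModulus h.choose_spec.2)
  else 1

/-- The `V`-depth `[V : V ∩ V ^ g]` of `g`, where `V ^ g = g V g⁻¹`. -/
noncomputable def depth {G : Type u} [Group G] (V : Subgroup G) (g : G) : ℕ :=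
  (V ⊓ V.map (MulAut.conj g).toMonoidHom).relIndex V

/-- The depth profile `𝒟(G, V)`: the set of `V`-depths of the elements of modulus `±1`. -/
def depthProfile {G : Type u} [Group G] (V : Subgroup G) : Set ℕ :=
  {d | ∃ g : G, (modularHom G g = 1 ∨ modularHom G g = -1) ∧ d = depth V g}

/-- The set `S / r = {n / gcd(r, n) | n ∈ S}`. -/
def truncDiv (S : Set ℕ) (r : ℕ) : Set ℕ :=
  {k | ∃ n ∈ S, k = n / Nat.gcd r n}

/-- The equivalence relation on sets of natural numbers generated by `S ~ S / r`, `r ≥ 1`. -/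
def DepthEquiv : Set ℕ → Set ℕ → Prop :=
  Relation.EqvGen (fun S S' => ∃ r : ℕ, 0 < r ∧ S' = truncDiv S r)

/-- Abstract commensurability: there are isomorphic subgroups of finite index. -/
def AbstractlyCommensurable (G : Type u) (H : Type v) [Group G] [Group H] : Prop :=
  ∃ (G' : Subgroup G) (H' : Subgroup H), G'.FiniteIndex ∧ H'.FiniteIndex ∧ Nonempty (G' ≃* H')

/-!
Everything is computed in one non-elementary GBS tree `X` of `G`.

Elliptic elements have an algebraic description. An element fixing a vertex of any GBS tree is
commensurable with all its conjugates. Conversely, an element without fixed vertex in `X` translates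
an axis (`GBSTree.exists_axis`), and an axis is determined by any non-trivial power
(`GBSTree.range_subset_of_translates`); if the element were commensurable with all its conjugates,
its axis would be an invariant line. Hence `IsCommensuratedElement` is the notion of a non-trivial
elliptic element, independently of the tree, any two such elements have a common non-trivial power,
and each of them computes the modular homomorphism.

A non-trivial elliptic subgroup is infinite cyclic, `V = ⟨v⟩`, and the depth of `g` is the number
`K` with `g⁻¹ v ^ i g ∈ V ↔ K ∣ i` (`depth_dvd_iff`). If `g` has modulus `±1` then
`g⁻¹ v ^ K g = v ^ (±K)`, and replacing `v` by `v ^ r` replaces `K` by `K / gcd(r, K)`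
(`depth_zpowers_pow`). This is the second claim.

For a subgroup `G'` of finite index, the tree `X` stays non-elementary: a finite orbit has a
fixed centre, and an invariant line of `G'` is the common axis of all elements of
`G` without fixed vertex, if there are any.
The point of the first claim is that depths of elements of modulus `±1` are already realized in
`G'` (`GBSTree.exists_mem_depth_eq`). Let `c` generate the stabilizer of `x`, let `g` have depth
`K > 1` with respect to `c`, and put `c' = g c g⁻¹`. Then `c ^ K = c' ^ (±K)`, so a power `c ^ i`
which fixes a vertex fixed by `c'` equals `c' ^ (±i)`; it therefore fixes `g x`, and `K ∣ i`. In
particular `c` and `c'` have no common fixed vertex, and ping-pong shows that the geodesic from `x`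
to `(c' c) ^ n x` passes through a vertex fixed by `c'`. So `(c' c) ^ n`, which commutes with
`c ^ K`, has depth exactly `K`, and some such power lies in `G'`.

The third claim combines the first two with the fact that any two non-trivial elliptic elements
have a common non-trivial power.
-/

/-! ### Metric geometry of simplicial trees -/

namespace SimpleGraph

variable {V : Type*} {T : SimpleGraph V}

/-- The vertex `y` lies on a geodesic from `x` to `z`. -/
def DistBetween (T : SimpleGraph V) (x y z : V) : Prop :=
  T.dist x y + T.dist y z = T.dist x z

theorem DistBetween.symm {x y z : V} (h : T.DistBetween x y z) : T.DistBetween z y x := by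
  unfold DistBetween at *
  rw [T.dist_comm (u := z) (v := y), T.dist_comm (u := y) (v := x), T.dist_comm (u := z) (v := x)]
  omega

/-- A bi-infinite sequence of vertices which is an isometric embedding of the simplicial line. -/
def IsGeodesicLine (T : SimpleGraph V) (l : ℤ → V) : Prop :=
  ∀ i j : ℤ, (T.dist (l i) (l j) : ℤ) = |i - j|

theorem IsGeodesicLine.injective {l : ℤ → V} (hl : T.IsGeodesicLine l) :
    Function.Injective l := by
  intro i j hij
  have h := hl i j
  rw [hij, dist_self] at h
  exact sub_eq_zero.1 (abs_eq_zero.1 (by simpa using h.symm))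

namespace IsTree

theorem exists_closer_adj (hT : T.IsTree) {x p : V} (h : p ≠ x) :
    ∃ q, T.Adj p q ∧ T.dist x q + 1 = T.dist x p := by
  obtain ⟨w, hw⟩ := hT.connected.exists_walk_length_eq_dist p x
  cases w with
  | nil => exact absurd rfl h
  | @cons _ q _ hadj w =>
    refine ⟨q, hadj, ?_⟩
    rw [Walk.length_cons] at hw
    have h1 := dist_le w
    rw [dist_comm, T.dist_comm (u := x)]
    rcases hT.dist_eq_dist_add_one_of_adj x hadj with h2 | h2 <;>
      rw [T.dist_comm (u := x), T.dist_comm (u := x)] at h2 <;> omega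

theorem closer_adj_unique (hT : T.IsTree) {x p q q' : V} (h : T.Adj p q) (h' : T.Adj p q')
    (hq : T.dist x q + 1 = T.dist x p) (hq' : T.dist x q' + 1 = T.dist x p) : q = q' := by
  obtain ⟨w, hw⟩ := hT.connected.exists_walk_length_eq_dist q x
  obtain ⟨w', hw'⟩ := hT.connected.exists_walk_length_eq_dist q' x
  have h1 : (Walk.cons h w).IsPath := by
    apply Walk.isPath_of_length_eq_dist
    rw [Walk.length_cons, hw, T.dist_comm, hq, T.dist_comm]
  have h2 : (Walk.cons h' w').IsPath := by
    apply Walk.isPath_of_length_eq_dist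
    rw [Walk.length_cons, hw', T.dist_comm, hq', T.dist_comm]
  have h3 := congrArg Subtype.val
    ((hT.isAcyclic.subsingleton_path _ _).elim ⟨Walk.cons h w, h1⟩ ⟨Walk.cons h' w', h2⟩)
  simpa using congrArg Walk.snd h3

/-- A geodesic whose first step leads away from `x` keeps leading away from `x`. -/
theorem distBetween_of_step (hT : T.IsTree) {x w : V} {p q : V} (hpq : T.Adj p q)
    (hw : T.dist w q + 1 = T.dist w p) (hx : T.dist x q = T.dist x p + 1) :
    T.DistBetween x p w := by
  induction hn : T.dist w q generalizing p q with
  | zero =>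
    have h1 : w = q := hT.connected.dist_eq_zero_iff.1 hn
    subst h1
    unfold DistBetween
    rw [hx, T.dist_comm (u := p), ← hw, hn]
  | succ n ih =>
    have hne : q ≠ w := by
      rintro rfl
      simp at hn
    obtain ⟨s, hqs, hs⟩ := hT.exists_closer_adj hne
    have hxs : T.dist x s = T.dist x q + 1 := by
      rcases hT.dist_eq_dist_add_one_of_adj x hqs with h1 | h1
      · have h2 := hT.closer_adj_unique hqs hpq.symm (x := x) h1.symm hx.symm
        subst h2
        omega
      · exact h1
    have h3 := ih hqs hs hxs (by omega)
    unfold DistBetween at *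
    rw [T.dist_comm (u := q)] at h3
    rw [T.dist_comm (u := p)]
    omega

/-- If `p` does not separate `x` from `w`, then the geodesics from `p` to `x` and to `w` have the
same first edge. -/
theorem exists_common_closer_adj (hT : T.IsTree) {x p w : V} (h : ¬ T.DistBetween x p w) :
    ∃ q, T.Adj p q ∧ T.dist x q + 1 = T.dist x p ∧ T.dist w q + 1 = T.dist w p := by
  have hpw : p ≠ w := by
    rintro rfl
    exact h (by simp [DistBetween])
  obtain ⟨q, hq, hqw⟩ := hT.exists_closer_adj hpw
  refine ⟨q, hq, ?_, hqw⟩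
  rcases hT.dist_eq_dist_add_one_of_adj x hq with h1 | h1
  · exact h1.symm
  · exact absurd (hT.distBetween_of_step hq hqw h1) h

/-- A vertex of a geodesic triangle's side lies on one of the other two sides. -/
theorem distBetween_or (hT : T.IsTree) {p y p' : V} (h : T.DistBetween p y p') (q : V) :
    T.DistBetween p y q ∨ T.DistBetween q y p' := by
  by_contra! hc
  obtain ⟨s, hs, h1, h2⟩ := hT.exists_common_closer_adj hc.1
  obtain ⟨s', hs', h3, h4⟩ := hT.exists_common_closer_adj hc.2
  obtain rfl := hT.closer_adj_unique hs hs' h2 h3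
  have h5 := hT.connected.dist_triangle (u := p) (v := s) (w := p')
  unfold DistBetween at h
  rw [T.dist_comm (u := s)] at h5
  rw [T.dist_comm (u := y)] at h
  omega

theorem eq_of_distBetween (hT : T.IsTree) {p y z q : V} (hy : T.DistBetween p y q)
    (hz : T.DistBetween p z q) (h : T.dist p y = T.dist p z) : y = z := by
  have h1 := hT.distBetween_or hy z
  unfold DistBetween at *
  apply hT.connected.dist_eq_zero_iff.1
  rcases h1 with h1 | h1
  · omega
  · rw [T.dist_comm (u := z) (v := y)] at h1
    omega

/-- A bi-infinite walk without backtracking is geodesic. -/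
theorem isGeodesicLine (hT : T.IsTree) {l : ℤ → V} (hadj : ∀ i, T.Adj (l i) (l (i + 1)))
    (hne : ∀ i, l i ≠ l (i + 2)) : T.IsGeodesicLine l := by
  have key : ∀ (i : ℤ) (k : ℕ), T.dist (l i) (l (i + k)) = k ∧
      T.dist (l i) (l (i + k + 1)) = k + 1 := by
    intro i k
    induction k with
    | zero => simpa using dist_eq_one_iff_adj.2 (hadj i)
    | succ k ih =>
      have e : i + ((k + 1 : ℕ) : ℤ) = i + k + 1 := by push_cast; ring
      rw [e]
      refine ⟨ih.2, ?_⟩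
      rcases hT.dist_eq_dist_add_one_of_adj (l i) (hadj (i + k + 1)) with h | h
      · have h2 := hT.closer_adj_unique (hadj (i + k + 1)) (hadj (i + k)).symm h.symm (by omega)
        refine absurd h2.symm ?_
        have := hne (i + k)
        rwa [show i + (k : ℤ) + 2 = i + k + 1 + 1 by ring] at this
      · omega
  have key2 : ∀ i j : ℤ, i ≤ j → (T.dist (l i) (l j) : ℤ) = |i - j| := by
    intro i j hij
    obtain ⟨k, rfl⟩ := Int.le.dest hij
    rw [(key i k).1]
    simp
  intro i j
  rcases le_total i j with h | h
  · exact key2 i j h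
  · rw [T.dist_comm, key2 j i h, abs_sub_comm]

end IsTree

end SimpleGraph

/-- An isometry of the integers is a translation or a reflection. -/
theorem Int.isometry_eq (σ : ℤ → ℤ) (h : ∀ i j, |σ i - σ j| = |i - j|) :
    ∃ t, (∀ i, σ i = i + t) ∨ (∀ i, σ i = t - i) := by
  refine ⟨σ 0, ?_⟩
  have h01 := h 1 0
  rcases abs_eq_abs.1 h01 with h1 | h1
  · left
    intro i
    rcases abs_eq_abs.1 (h i 0) with h2 | h2 <;> rcases abs_eq_abs.1 (h i 1) with h3 | h3 <;> omega
  · right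
    intro i
    rcases abs_eq_abs.1 (h i 0) with h2 | h2 <;> rcases abs_eq_abs.1 (h i 1) with h3 | h3 <;> omega

/-! ### Fixed vertices and axes in a tree with a group action -/

namespace GBSTree

variable {G : Type u} [Group G] (X : GBSTree G)

theorem dist_smul (g : G) (x y : X.Vert) : X.graph.dist (g • x) (g • y) = X.graph.dist x y := by
  have key : ∀ (g : G) (x y : X.Vert), X.graph.dist (g • x) (g • y) ≤ X.graph.dist x y := by
    intro g x y
    obtain ⟨w, hw⟩ := X.isTree.connected.exists_walk_length_eq_dist x y
    rw [← hw, ← SimpleGraph.Walk.length_map (⟨fun z => g • z, fun h => X.adj_smul g _ _ h⟩ :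
      X.graph →g X.graph) w]
    exact SimpleGraph.dist_le _
  refine le_antisymm (key g x y) ?_
  simpa using key g⁻¹ (g • x) (g • y)

/-- The set of vertices fixed by an element is convex. -/
theorem smul_eq_of_distBetween {a : G} {x y z : X.Vert} (hx : a • x = x) (hz : a • z = z)
    (h : X.graph.DistBetween x y z) : a • y = y := by
  have h1 : X.graph.dist x (a • y) = X.graph.dist x y := by
    conv_lhs => rw [← hx]
    exact X.dist_smul a x y
  have h2 : X.graph.dist (a • y) z = X.graph.dist y z := by
    conv_lhs => rw [← hz]
    exact X.dist_smul a y z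
  refine X.isTree.eq_of_distBetween (p := x) (q := z) ?_ h h1
  unfold SimpleGraph.DistBetween at *
  omega

/-- The centre of a finite orbit is a fixed vertex. -/
theorem exists_fixed_of_finite_orbit {x : X.Vert} (hx : (MulAction.orbit G x).Finite) :
    ∃ y : X.Vert, ∀ g : G, g • y = y := by
  classical
  set O := hx.toFinset with hO
  have hmem : ∀ (g : G) (z : X.Vert), z ∈ O → g • z ∈ O := by
    intro g z hz
    rw [hO, Set.Finite.mem_toFinset] at *
    obtain ⟨h, rfl⟩ := hz
    exact ⟨g * h, mul_smul g h x⟩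
  have hne : x ∈ O := by
    rw [hO, Set.Finite.mem_toFinset]
    exact MulAction.mem_orbit_self x
  let e : X.Vert → ℕ := fun y => O.sup (fun z => X.graph.dist y z)
  have he : ∀ (g : G) y, e (g • y) ≤ e y := by
    intro g y
    refine Finset.sup_le fun z hz => ?_
    have h1 : X.graph.dist (g • y) z = X.graph.dist y (g⁻¹ • z) := by
      rw [← X.dist_smul g⁻¹, inv_smul_smul]
    rw [h1]
    exact Finset.le_sup (f := fun z => X.graph.dist y z) (hmem _ _ hz)
  obtain ⟨y, hy⟩ : ∃ y, ∀ y', e y ≤ e y' := by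
    have hex : ∃ n, ∃ y, e y = n := ⟨_, x, rfl⟩
    obtain ⟨y, hy⟩ := Nat.find_spec hex
    exact ⟨y, fun y' => hy ▸ Nat.find_min' hex ⟨y', rfl⟩⟩
  -- Two minimisers of the eccentricity `e` are at distance at most one.
  have hclose : ∀ y', e y' ≤ e y → X.graph.dist y y' ≤ 1 := by
    intro y' hy'
    by_contra! hd
    have hyy : y' ≠ y := by
      rintro rfl
      simp at hd
    obtain ⟨m, hm, hm'⟩ := X.isTree.exists_closer_adj hyy
    have hm1 : X.graph.dist m y' = 1 :=
      SimpleGraph.dist_eq_one_iff_adj.2 hm.symm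
    have hb : X.graph.DistBetween y m y' := by
      unfold SimpleGraph.DistBetween
      omega
    obtain ⟨z, hz, hzm⟩ := Finset.exists_mem_eq_sup O ⟨x, hne⟩ (fun z => X.graph.dist m z)
    have h1 : X.graph.dist y z ≤ e y := Finset.le_sup (f := fun z => X.graph.dist y z) hz
    have h2 : X.graph.dist y' z ≤ e y' := Finset.le_sup (f := fun z => X.graph.dist y' z) hz
    have h3 : e y ≤ X.graph.dist m z := hzm ▸ hy m
    rcases X.isTree.distBetween_or hb z with h4 | h4
    · unfold SimpleGraph.DistBetween at h4
      omega
    · have h5 := h4.symm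
      unfold SimpleGraph.DistBetween at h5
      rw [X.graph.dist_comm (u := y')] at h5
      omega
  refine ⟨y, fun g => ?_⟩
  by_contra hg
  have hadj : ∀ g : G, g • y ≠ y → X.graph.Adj y (g • y) := by
    intro g hg
    rw [← SimpleGraph.dist_eq_one_iff_adj]
    have h1 := hclose (g • y) (he g y)
    have h2 := X.isTree.connected.pos_dist_of_ne (Ne.symm hg)
    omega
  have h1 := hadj g hg
  have h2 : g • g • y = y := by
    by_contra h3
    rw [← mul_smul] at h3
    have h4 := hadj (g * g) h3
    rw [mul_smul] at h4
    have h5 := X.adj_smul g _ _ h1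
    refine X.isTree.dist_ne_of_adj y h5 ?_
    rw [SimpleGraph.dist_eq_one_iff_adj.2 h1, SimpleGraph.dist_eq_one_iff_adj.2 h4]
  exact X.no_inversion g _ _ h1 ⟨rfl, h2⟩

theorem zpow_smul_line {l : ℤ → X.Vert} {g : G} {n : ℤ} (h : ∀ i, g • l i = l (i + n)) (k i : ℤ) :
    g ^ k • l i = l (i + k * n) := by
  induction k with
  | zero => simp
  | succ k ih => rw [add_comm, zpow_one_add, mul_smul, ih, h, add_mul, add_assoc, one_mul,
      add_comm n]
  | pred k ih =>
    rw [sub_eq_neg_add, zpow_add, zpow_neg_one, mul_smul, ih, inv_smul_eq_iff, h]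
    congr 1
    ring

/-- A non-trivial translation of a line fixes no vertex of the tree. -/
theorem smul_ne_of_translates {l : ℤ → X.Vert} (hl : X.graph.IsGeodesicLine l) {g : G} {n : ℤ}
    (hn : n ≠ 0) (h : ∀ i, g • l i = l (i + n)) (y : X.Vert) : g • y ≠ y := by
  intro hy
  set D := X.graph.dist (l 0) y with hD
  have h1 : g ^ (2 * D + 1) • y = y := 
    (MulAction.stabilizer G y).pow_mem (x := g) hy _
  have h2 : X.graph.dist (l ((2 * D + 1 : ℕ) * n)) y = D := by
    have h3 := X.zpow_smul_line h (2 * D + 1 : ℕ) 0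
    rw [zero_add, zpow_natCast] at h3
    rw [← h3]
    conv_lhs => rw [← h1]
    exact X.dist_smul _ _ _
  have h3 := X.isTree.connected.dist_triangle (u := l 0) (v := y) (w := l ((2 * D + 1 : ℕ) * n))
  rw [X.graph.dist_comm (u := y), h2, ← hD] at h3
  have h4 := hl 0 ((2 * D + 1 : ℕ) * n)
  rw [zero_sub, abs_neg, abs_mul, Nat.abs_cast] at h4
  have h5 : 1 ≤ |n| := Int.one_le_abs hn
  have h6 : ((2 * D + 1 : ℕ) : ℤ) ≤ X.graph.dist (l 0) (l ((2 * D + 1 : ℕ) * n)) := by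
    rw [h4]
    exact le_mul_of_one_le_right (by positivity) h5
  omega

/-- An element without fixed vertex has an axis: the line through a vertex which is displaced
as little as possible. -/
theorem exists_axis {g : G} (hg : ∀ x : X.Vert, g • x ≠ x) :
    ∃ (l : ℤ → X.Vert) (n : ℤ), X.graph.IsGeodesicLine l ∧ n ≠ 0 ∧ ∀ i, g • l i = l (i + n) := by
  classical
  obtain ⟨x, hx⟩ : ∃ x, ∀ y, X.graph.dist x (g • x) ≤ X.graph.dist y (g • y) := by
    obtain ⟨x₀⟩ := X.isTree.connected.nonempty
    have hex : ∃ n, ∃ y : X.Vert, X.graph.dist y (g • y) = n := ⟨_, x₀, rfl⟩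
    obtain ⟨y, hy⟩ := Nat.find_spec hex
    exact ⟨y, fun y' => hy ▸ Nat.find_min' hex ⟨y', rfl⟩⟩
  obtain ⟨w, hw⟩ := X.isTree.connected.exists_walk_length_eq_dist x (g • x)
  set n := X.graph.dist x (g • x) with hn
  have hn0 : 0 < n := X.isTree.connected.pos_dist_of_ne (hg x).symm
  let l : ℤ → X.Vert := fun i => g ^ (i / n) • w.getVert (i % n).toNat
  have hl : ∀ (q : ℤ) (r : ℕ), r ≤ n → l (q * n + r) = g ^ q • w.getVert r := by
    intro q r hr
    rcases hr.lt_or_eq with hr | hr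
    · have h1 : (q * n + r) / (n : ℤ) = q := by
        rw [add_comm, Int.add_mul_ediv_right _ _ (by omega),
          Int.ediv_eq_zero_of_lt (by omega) (by omega), zero_add]
      have h2 : (q * n + r) % (n : ℤ) = r := by
        rw [add_comm, Int.add_mul_emod_self_right, Int.emod_eq_of_lt (by omega) (by omega)]
      simp only [l, h1, h2, Int.toNat_natCast]
    · have h1 : (q * n + n) / (n : ℤ) = q + 1 := by
        rw [← add_one_mul, Int.mul_ediv_cancel _ (by omega)]
      have h2 : (q * n + n) % (n : ℤ) = 0 := by
        rw [← add_one_mul, Int.mul_emod_left]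
      simp only [l, hr, h1, h2, Int.toNat_zero, SimpleGraph.Walk.getVert_zero]
      rw [← hw, SimpleGraph.Walk.getVert_length, zpow_add_one, mul_smul]
  have hrep : ∀ i : ℤ, ∃ (q : ℤ) (r : ℕ), r < n ∧ i = q * n + r := by
    intro i
    refine ⟨i / n, (i % n).toNat, ?_, ?_⟩
    · have := Int.emod_lt_of_pos i (b := n) (by omega)
      omega
    · rw [Int.toNat_of_nonneg (Int.emod_nonneg _ (by omega)), Int.ediv_mul_add_emod]
  have htr : ∀ i, g • l i = l (i + n) := by
    intro i
    obtain ⟨q, r, hr, rfl⟩ := hrep i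
    rw [hl q r hr.le, show q * (n : ℤ) + r + n = (q + 1) * n + r by ring, hl _ r hr.le,
      ← mul_smul, ← zpow_one_add, add_comm]
  have hadj : ∀ i, X.graph.Adj (l i) (l (i + 1)) := by
    intro i
    obtain ⟨q, r, hr, rfl⟩ := hrep i
    rw [show q * (n : ℤ) + r + 1 = q * n + (r + 1 : ℕ) by push_cast; ring, hl q r hr.le,
      hl q (r + 1) hr]
    exact X.adj_smul _ _ _ (w.adj_getVert_succ (by omega))
  have hle : ∀ (i : ℤ) (k : ℕ), X.graph.dist (l i) (l (i + k)) ≤ k := by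
    intro i k
    induction k with
    | zero => simp
    | succ k ih =>
      have h1 := X.isTree.connected.dist_triangle (u := l i) (v := l (i + k))
        (w := l (i + (k + 1 : ℕ)))
      have h2 : X.graph.dist (l (i + k)) (l (i + (k + 1 : ℕ))) = 1 := by
        rw [SimpleGraph.dist_eq_one_iff_adj]
        have := hadj (i + k)
        rwa [show i + (k : ℤ) + 1 = i + (k + 1 : ℕ) by push_cast; ring] at this
      omega
  refine ⟨l, n, X.isTree.isGeodesicLine hadj fun i hi => ?_, by omega, htr⟩
  rcases Nat.lt_or_ge n 2 with h2 | h2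
  · -- Displacement one: backtracking means that `g` inverts an edge.
    have h3 : n = 1 := by omega
    have h4 := htr i
    have h5 := htr (i + 1)
    rw [h3, Nat.cast_one] at h4 h5
    rw [show i + 1 + 1 = i + 2 by ring, ← hi] at h5
    exact X.no_inversion g _ _ (hadj i) ⟨h4, h5⟩
  · -- Otherwise a backtracking vertex would be displaced by less than `n`.
    have h3 := hx (l i)
    rw [htr, hi] at h3
    have h4 := hle (i + 2) (n - 2)
    rw [show i + 2 + ((n - 2 : ℕ) : ℤ) = i + n by omega] at h4
    omega

/-- A line translated by a given element is determined by that element: the geodesic between two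
far translates of a vertex of `l'` has to follow `l`. -/
theorem range_subset_of_translates {l l' : ℤ → X.Vert} (hl : X.graph.IsGeodesicLine l)
    (hl' : X.graph.IsGeodesicLine l') {g : G} {n n' : ℤ} (hn' : n' ≠ 0)
    (h : ∀ i, g • l i = l (i + n)) (h' : ∀ i, g • l' i = l' (i + n')) :
    Set.range l' ⊆ Set.range l := by
  rintro _ ⟨j, rfl⟩
  set D := X.graph.dist (l' j) (l 0) with hD
  have hfar : ∀ k : ℤ, X.graph.dist (l' (j + k * n')) (l (k * n)) = D := by
    intro k
    have h1 := X.zpow_smul_line h k 0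
    rw [zero_add] at h1
    rw [← X.zpow_smul_line h', ← h1]
    exact X.dist_smul _ _ _
  have hlong : ∀ k : ℤ, |k| = D + 1 → D < X.graph.dist (l' (j + k * n')) (l' j) := by
    intro k hk
    have h1 := hl' (j + k * n') j
    rw [add_sub_cancel_left, abs_mul, hk] at h1
    have h2 : (D : ℤ) + 1 ≤ X.graph.dist (l' (j + k * n')) (l' j) := by
      rw [h1]
      exact le_mul_of_one_le_right (by positivity) (Int.one_le_abs hn')
    omega
  -- The vertex `l' j` lies between two far away translates; so it lies on `l`, which runs close
  -- to both of them.
  set k : ℤ := D + 1 with hk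
  have hk0 : |k| = D + 1 := abs_of_nonneg (by positivity)
  have hb : X.graph.DistBetween (l' (j + (-k) * n')) (l' j) (l' (j + k * n')) := by
    unfold SimpleGraph.DistBetween
    zify
    rw [hl', hl', hl', add_sub_cancel_left, sub_add_cancel_left,
      show j + -k * n' - (j + k * n') = 2 * (-k * n') by ring, abs_mul 2, abs_neg, neg_mul, abs_neg]
    norm_num
    ring
  have h1 := hlong k hk0
  have h2 := hlong (-k) (by rw [abs_neg, hk0])
  have h3 := hfar k
  have h4 := hfar (-k)
  have hb2 : X.graph.DistBetween (l (-k * n)) (l' j) (l' (j + k * n')) := by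
    rcases X.isTree.distBetween_or hb (l (-k * n)) with h5 | h5
    · unfold SimpleGraph.DistBetween at h5
      omega
    · exact h5
  have hb3 : X.graph.DistBetween (l (-k * n)) (l' j) (l (k * n)) := by
    rcases X.isTree.distBetween_or hb2 (l (k * n)) with h5 | h5
    · exact h5
    · have h6 := h5.symm
      unfold SimpleGraph.DistBetween at h6
      omega
  set t := X.graph.dist (l (-k * n)) (l' j) with ht
  have hlen : X.graph.dist (l (-k * n)) (l (k * n)) = |2 * (k * n)| := by
    rw [hl, show -k * n - k * n = -(2 * (k * n)) by ring, abs_neg]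
  have htle : (t : ℤ) ≤ |2 * (k * n)| := by
    rw [← hlen]
    unfold SimpleGraph.DistBetween at hb3
    omega
  have hsgn : ∃ s : ℤ, X.graph.dist (l (-k * n)) (l s) = t ∧
      X.graph.DistBetween (l (-k * n)) (l s) (l (k * n)) := by
    unfold SimpleGraph.DistBetween
    rcases le_total 0 (k * n) with h5 | h5
    · rw [abs_of_nonneg (by omega)] at htle
      refine ⟨-k * n + t, ?_, ?_⟩
      · zify
        rw [hl, sub_add_cancel_left, abs_neg, Nat.abs_cast]
      · zify
        rw [hl, hl, hl, neg_mul, abs_of_nonpos (by omega), abs_of_nonpos (by omega),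
          abs_of_nonpos (by omega)]
        ring
    · rw [abs_of_nonpos (by omega)] at htle
      refine ⟨-k * n - t, ?_, ?_⟩
      · zify
        rw [hl, sub_sub_cancel, Nat.abs_cast]
      · zify
        rw [hl, hl, hl, neg_mul, abs_of_nonneg (by omega), abs_of_nonneg (by omega),
          abs_of_nonneg (by omega)]
        ring
  obtain ⟨s, hs, hs'⟩ := hsgn
  exact ⟨s, X.isTree.eq_of_distBetween hs' hb3 hs⟩

/-- The lines of `IsElementary` are geodesic. -/
theorem isGeodesicLine_of_injective {l : ℤ → X.Vert} (hi : Function.Injective l)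
    (ha : ∀ i, X.graph.Adj (l i) (l (i + 1))) : X.graph.IsGeodesicLine l :=
  X.isTree.isGeodesicLine ha fun i h => by
    have := hi h
    omega

theorem isElementary_of_line {l : ℤ → X.Vert} (hl : X.graph.IsGeodesicLine l)
    (h : ∀ (g : G) (i : ℤ), g • l i ∈ Set.range l) : X.IsElementary :=
  Or.inr ⟨l, hl.injective, fun i => by
    rw [← SimpleGraph.dist_eq_one_iff_adj]
    have := hl i (i + 1)
    simpa using this, h⟩

theorem smul_line {l : ℤ → X.Vert} (hl : X.graph.IsGeodesicLine l) (g : G) :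
    X.graph.IsGeodesicLine (fun i => g • l i) := fun i j => by
  rw [X.dist_smul]
  exact hl i j

/-- An element preserving a line acts on it as a translation or as a reflection. -/
theorem translates_or_reflects {l : ℤ → X.Vert} (hl : X.graph.IsGeodesicLine l) {g : G}
    (h : ∀ i, g • l i ∈ Set.range l) :
    ∃ t, (∀ i, g • l i = l (i + t)) ∨ (∀ i, g • l i = l (t - i)) := by
  choose σ hσ using h
  obtain ⟨t, ht⟩ := Int.isometry_eq σ (fun i j => by
    rw [← hl, hσ, hσ, X.dist_smul, hl])
  refine ⟨t, ht.imp (fun h i => ?_) (fun h i => ?_)⟩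
  · rw [← hσ, h]
  · rw [← hσ, h]

end GBSTree

/-! ### Elliptic elements and the modular homomorphism -/

section Modulus

variable {G : Type u} [Group G]

theorem IsModulus.zpow {a g : G} {t : ℚ} (h : IsModulus a g t) (k : ℤ) : IsModulus (a ^ k) g t := by
  obtain ⟨m, n, hm, hn, e, rfl⟩ := h
  refine ⟨m, n, hm, hn, ?_, rfl⟩
  rw [← zpow_mul, mul_comm, zpow_mul, ← conj_zpow_aux, e, ← zpow_mul, ← zpow_mul, mul_comm]

theorem IsModulus.of_zpow {a g : G} {t : ℚ} {k : ℤ} (hk : k ≠ 0) (h : IsModulus (a ^ k) g t) :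
    IsModulus a g t := by
  obtain ⟨m, n, hm, hn, e, rfl⟩ := h
  refine ⟨k * m, k * n, mul_ne_zero hk hm, mul_ne_zero hk hn, by rw [zpow_mul, e, zpow_mul], ?_⟩
  push_cast
  rw [mul_div_mul_left _ _ (by exact_mod_cast hk)]

theorem isModulus_zpow_iff {a g : G} {t : ℚ} {k : ℤ} (hk : k ≠ 0) :
    IsModulus (a ^ k) g t ↔ IsModulus a g t :=
  ⟨IsModulus.of_zpow hk, fun h => h.zpow k⟩

theorem IsModulus.map {H : Type v} [Group H] {a g : G} {t : ℚ} (h : IsModulus a g t)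
    (φ : G →* H) : IsModulus (φ a) (φ g) t := by
  obtain ⟨m, n, hm, hn, e, rfl⟩ := h
  exact ⟨m, n, hm, hn, by rw [← map_inv, ← map_zpow, ← map_mul, ← map_mul, e, map_zpow], rfl⟩

theorem IsModulus.of_map {H : Type v} [Group H] {a g : G} {t : ℚ} {φ : G →* H}
    (hφ : Function.Injective φ) (h : IsModulus (φ a) (φ g) t) : IsModulus a g t := by
  obtain ⟨m, n, hm, hn, e, rfl⟩ := h
  refine ⟨m, n, hm, hn, hφ ?_, rfl⟩
  rw [map_mul, map_mul, map_inv, map_zpow, e, map_zpow]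

/-- A non-trivial element which is commensurable with all its conjugates. In a non-elementary GBS
group these are exactly the non-trivial elliptic elements. -/
def IsCommensuratedElement (a : G) : Prop :=
  a ≠ 1 ∧ ∀ g : G, ∃ t : ℚ, IsModulus a g t

/-- The axis of a fixed-point-free element commensurable with all its conjugates would be an
invariant line. -/
theorem GBSTree.exists_smul_eq_of_commensurated (X : GBSTree G) (hX : ¬ X.IsElementary) {a : G}
    (ha : IsCommensuratedElement a) : ∃ x : X.Vert, a • x = x := by
  by_contra! hfix
  obtain ⟨l, n, hl, hn, htr⟩ := X.exists_axis hfix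
  refine hX (X.isElementary_of_line hl fun g i => ?_)
  obtain ⟨t, m, p, hm, hp, e, -⟩ := ha.2 g
  have h1 : ∀ i, a ^ m • g • l i = g • l (i + p * n) := by
    intro i
    rw [← X.zpow_smul_line htr, ← e, ← mul_smul, ← mul_smul]
    congr 1
    group
  exact X.range_subset_of_translates hl (X.smul_line hl g) (mul_ne_zero hp hn)
    (X.zpow_smul_line htr m) h1 ⟨i, rfl⟩

theorem IsElliptic.isCommensuratedElement {a : G} (h : IsElliptic a) (ha : a ≠ 1) :
    IsCommensuratedElement a :=
  ⟨ha, h.exists_isModulus ha⟩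

theorem IsCommensuratedElement.isElliptic {a : G} (ha : IsCommensuratedElement a)
    (hG : IsNonelementaryGBS G) : IsElliptic a := by
  obtain ⟨X, hX⟩ := hG
  exact ⟨X, X.exists_smul_eq_of_commensurated hX ha⟩

theorem IsCommensuratedElement.zpow_injective {a : G} (ha : IsCommensuratedElement a)
    (hG : IsNonelementaryGBS G) : Function.Injective (fun k : ℤ => a ^ k) :=
  (ha.isElliptic hG).zpow_injective ha.1

theorem IsCommensuratedElement.zpow {a : G} (ha : IsCommensuratedElement a)
    (hG : IsNonelementaryGBS G) {k : ℤ} (hk : k ≠ 0) : IsCommensuratedElement (a ^ k) := by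
  refine ⟨fun h => hk (ha.zpow_injective hG (by simpa using h)), fun g => ?_⟩
  obtain ⟨t, ht⟩ := ha.2 g
  exact ⟨t, ht.zpow k⟩

theorem IsCommensuratedElement.map {H : Type v} [Group H] {a : G} (ha : IsCommensuratedElement a)
    (φ : G ≃* H) : IsCommensuratedElement (φ a) := by
  refine ⟨fun h => ha.1 (φ.injective (by rw [h, map_one])), fun g => ?_⟩
  obtain ⟨t, ht⟩ := ha.2 (φ.symm g)
  refine ⟨t, ?_⟩
  simpa using ht.map φ.toMonoidHom

theorem IsCommensuratedElement.subgroup {G' : Subgroup G} {a : G'}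
    (ha : IsCommensuratedElement (a : G)) : IsCommensuratedElement a := by
  refine ⟨fun h => ha.1 (by rw [h]; rfl), fun g => ?_⟩
  obtain ⟨t, ht⟩ := ha.2 g
  exact ⟨t, IsModulus.of_map (φ := G'.subtype) G'.subtype_injective ht⟩

/-- Any two non-trivial elliptic elements of a non-elementary GBS group are commensurable. -/
theorem IsCommensuratedElement.exists_zpow_eq {a b : G} (hG : IsNonelementaryGBS G)
    (ha : IsCommensuratedElement a) (hb : IsCommensuratedElement b) :
    ∃ m n : ℤ, m ≠ 0 ∧ n ≠ 0 ∧ a ^ m = b ^ n := by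
  have hainj := ha.zpow_injective hG
  obtain ⟨X, hX⟩ := hG
  obtain ⟨x, hx⟩ := X.exists_smul_eq_of_commensurated hX ha
  obtain ⟨y, hy⟩ := X.exists_smul_eq_of_commensurated hX hb
  obtain ⟨k, hk, hky⟩ := X.exists_zpow x y hx
  obtain ⟨c, -, hc⟩ := X.exists_generator y
  obtain ⟨i, hi⟩ := hc _ hky
  obtain ⟨j, rfl⟩ := hc _ hy
  have hj : j ≠ 0 := by
    rintro rfl
    exact hb.1 (by simp)
  have hi0 : i ≠ 0 := by
    rintro rfl
    exact hk (hainj (by simpa using hi))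
  refine ⟨k * j, i, mul_ne_zero hk hj, hi0, ?_⟩
  rw [zpow_mul, hi, ← zpow_mul, ← zpow_mul, mul_comm]

/-- The value of the modular homomorphism may be computed with any non-trivial elliptic
element. -/
theorem IsCommensuratedElement.isModulus_modularHom {v : G} (hG : IsNonelementaryGBS G)
    (hv : IsCommensuratedElement v) (g : G) : IsModulus v g (modularHom G g : ℚ) := by
  have hex : ∃ a : G, IsElliptic a ∧ a ≠ 1 := ⟨v, hv.isElliptic hG, hv.1⟩
  have ha := hex.choose_spec
  set a := hex.choose with hadef
  have h1 : IsModulus a g (modularHom G g : ℚ) := by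
    rw [modularHom, dif_pos hex]
    exact (ha.1.exists_isModulus ha.2 g).choose_spec
  obtain ⟨m, n, hm, hn, e⟩ := (ha.1.isCommensuratedElement ha.2).exists_zpow_eq hG hv
  rw [← isModulus_zpow_iff hn, ← e]
  exact h1.zpow m

theorem IsCommensuratedElement.modularHom_eq_iff {v : G} (hG : IsNonelementaryGBS G)
    (hv : IsCommensuratedElement v) (g : G) (t : ℚˣ) :
    modularHom G g = t ↔ IsModulus v g t := by
  have h1 := hv.isModulus_modularHom hG g
  refine ⟨fun h => h ▸ h1, fun h => Units.ext (h1.unique (hv.zpow_injective hG) h)⟩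

end Modulus

/-! ### Depths with respect to a cyclic subgroup -/

section Depth

variable {G : Type u} [Group G]

theorem Subgroup.zpow_mem_iff_relIndex_dvd (S : Subgroup G) (v : G) (i : ℤ) :
    v ^ i ∈ S ↔ (S.relIndex (Subgroup.zpowers v) : ℤ) ∣ i := by
  set f : Multiplicative ℤ →* G := zpowersHom G v with hf
  have hr : f.range = Subgroup.zpowers v := by
    ext a
    simp [hf, Subgroup.mem_zpowers_iff, zpowersHom_apply, MonoidHom.mem_range]
  rw [← hr, ← Subgroup.index_comap]
  set A : AddSubgroup ℤ := (AddSubgroup.toSubgroup (A := ℤ)).symm (S.comap f) with hA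
  have hmem : v ^ i ∈ S ↔ i ∈ A := Iff.rfl
  have hidx : (S.comap f).index = A.index := rfl
  obtain ⟨n, hn⟩ := Int.subgroup_cyclic A
  rw [← AddSubgroup.zmultiples_eq_closure] at hn
  rw [hmem, hidx, hn, Int.index_zmultiples, Int.mem_zmultiples_iff, Int.natAbs_dvd]

theorem Nat.eq_of_forall_int_dvd_iff {a b : ℕ} (h : ∀ i : ℤ, (a : ℤ) ∣ i ↔ (b : ℤ) ∣ i) :
    a = b :=
  Nat.dvd_antisymm (Int.natCast_dvd_natCast.1 ((h b).2 dvd_rfl))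
    (Int.natCast_dvd_natCast.1 ((h a).1 dvd_rfl))

theorem depth_dvd_iff (v g : G) (i : ℤ) :
    (depth (Subgroup.zpowers v) g : ℤ) ∣ i ↔ g⁻¹ * v ^ i * g ∈ Subgroup.zpowers v := by
  rw [depth, ← Subgroup.zpow_mem_iff_relIndex_dvd, Subgroup.mem_inf]
  refine ⟨?_, fun h => ⟨⟨i, rfl⟩, _, h, ?_⟩⟩
  · rintro ⟨-, y, hy, e⟩
    have e' : g * y * g⁻¹ = v ^ i := e
    rw [← e']
    have e2 : g⁻¹ * (g * y * g⁻¹) * g = y := by group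
    rw [e2]
    exact hy
  · change g * (g⁻¹ * v ^ i * g) * g⁻¹ = v ^ i
    group

theorem depth_eq_of_forall {v g : G} {d : ℕ}
    (h : ∀ i : ℤ, g⁻¹ * v ^ i * g ∈ Subgroup.zpowers v ↔ (d : ℤ) ∣ i) :
    depth (Subgroup.zpowers v) g = d :=
  Nat.eq_of_forall_int_dvd_iff fun i => by rw [depth_dvd_iff, h]

theorem depth_pos_of_isModulus {v g : G} {t : ℚ} (h : IsModulus v g t) :
    0 < depth (Subgroup.zpowers v) g := by
  obtain ⟨m, n, hm, hn, e, rfl⟩ := h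
  have h1 := (depth_dvd_iff v g m).2 ⟨n, e.symm⟩
  rw [Nat.pos_iff_ne_zero]
  intro h0
  rw [h0] at h1
  exact hm (by simpa using h1)

/-- An element of modulus `±1` acts on the intersection `V ∩ V ^ g`, for `V` cyclic, by `±1`. -/
theorem conj_zpow_depth {v g : G} (hv : Function.Injective (fun k : ℤ => v ^ k))
    (h : IsModulus v g 1 ∨ IsModulus v g (-1)) :
    ∃ ε : ℤ, (ε = 1 ∨ ε = -1) ∧
      g⁻¹ * v ^ (depth (Subgroup.zpowers v) g : ℤ) * g =
        v ^ (ε * (depth (Subgroup.zpowers v) g : ℤ)) := by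
  have hpos : 0 < depth (Subgroup.zpowers v) g :=
    h.elim depth_pos_of_isModulus depth_pos_of_isModulus
  set K := depth (Subgroup.zpowers v) g with hK
  obtain ⟨j, hj⟩ := (depth_dvd_iff v g K).1 dvd_rfl
  simp only at hj
  have hK0 : (K : ℤ) ≠ 0 := by omega
  have hj0 : j ≠ 0 := by
    rintro rfl
    have h2 : v ^ (K : ℤ) = 1 := by
      have h3 : v ^ (K : ℤ) = g * (g⁻¹ * v ^ (K : ℤ) * g) * g⁻¹ := by group
      rw [h3, ← hj]
      simp
    exact hK0 (hv (by simpa using h2))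
  have hmod : IsModulus v g ((K : ℤ) / j) := ⟨K, j, hK0, hj0, hj.symm, rfl⟩
  have hjq : (j : ℚ) ≠ 0 := by exact_mod_cast hj0
  rcases h with h | h
  · have h1 := hmod.unique hv h
    rw [div_eq_iff hjq, one_mul] at h1
    refine ⟨1, Or.inl rfl, ?_⟩
    rw [one_mul, ← hj, show (K : ℤ) = j by exact_mod_cast h1]
  · have h1 := hmod.unique hv h
    rw [div_eq_iff hjq] at h1
    refine ⟨-1, Or.inr rfl, ?_⟩
    rw [← hj, show (K : ℤ) = -1 * j by exact_mod_cast h1]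
    congr 1
    ring

theorem Nat.dvd_mul_iff_div_gcd_dvd {K r : ℕ} (hr : 0 < r) (i : ℤ) :
    (K : ℤ) ∣ r * i ↔ ((K / Nat.gcd r K : ℕ) : ℤ) ∣ i := by
  rw [Int.natCast_dvd, Int.natCast_dvd, Int.natAbs_mul, Int.natAbs_natCast,
    Nat.div_dvd_iff_dvd_mul (Nat.gcd_dvd_right r K) (Nat.gcd_pos_of_pos_left K hr),
    Nat.gcd_comm, Nat.dvd_gcd_mul_iff_dvd_mul]
/-- The depth with respect to a subgroup of index `r` of an infinite cyclic group. -/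
theorem depth_zpowers_pow {v g : G} (hv : Function.Injective (fun k : ℤ => v ^ k))
    (h : IsModulus v g 1 ∨ IsModulus v g (-1)) {r : ℕ} (hr : 0 < r) :
    depth (Subgroup.zpowers (v ^ r)) g =
      depth (Subgroup.zpowers v) g / Nat.gcd r (depth (Subgroup.zpowers v) g) := by
  obtain ⟨ε, -, he⟩ := conj_zpow_depth hv h
  set K := depth (Subgroup.zpowers v) g with hK
  refine depth_eq_of_forall fun i => ?_
  rw [← Nat.dvd_mul_iff_div_gcd_dvd hr, ← zpow_natCast, ← zpow_mul]
  constructor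
  · intro h1
    rw [hK, depth_dvd_iff]
    refine Subgroup.zpowers_le.2 ?_ h1
    exact Subgroup.zpow_mem _ (Subgroup.mem_zpowers v) _
  · rintro ⟨s, hs⟩
    refine ⟨ε * i, ?_⟩
    simp only
    rw [hs, zpow_mul v K, ← conj_zpow_aux, he, ← zpow_mul, ← zpow_mul, mul_assoc,
      ← hs]
    congr 1
    ring

theorem mem_depthProfile_zpowers {v : G} (hG : IsNonelementaryGBS G)
    (hv : IsCommensuratedElement v) (d : ℕ) :
    d ∈ depthProfile (Subgroup.zpowers v) ↔
      ∃ g : G, (IsModulus v g 1 ∨ IsModulus v g (-1)) ∧ d = depth (Subgroup.zpowers v) g := by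
  refine exists_congr fun g => and_congr_left fun _ => or_congr ?_ ?_
  · simpa using hv.modularHom_eq_iff hG g 1
  · simpa using hv.modularHom_eq_iff hG g (-1)

theorem depthProfile_zpowers_pow {v : G} (hG : IsNonelementaryGBS G)
    (hv : IsCommensuratedElement v) {r : ℕ} (hr : 0 < r) :
    depthProfile (Subgroup.zpowers (v ^ r)) = truncDiv (depthProfile (Subgroup.zpowers v)) r := by
  have hr0 : (r : ℤ) ≠ 0 := by omega
  have hvr : IsCommensuratedElement (v ^ r) := by
    rw [← zpow_natCast]
    exact hv.zpow hG hr0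
  have hinj := hv.zpow_injective hG
  have hmod : ∀ g t, IsModulus (v ^ r) g t ↔ IsModulus v g t := fun g t => by
    rw [← zpow_natCast, isModulus_zpow_iff hr0]
  ext d
  rw [mem_depthProfile_zpowers hG hvr]
  constructor
  · rintro ⟨g, hg, rfl⟩
    rw [hmod, hmod] at hg
    exact ⟨_, (mem_depthProfile_zpowers hG hv _).2 ⟨g, hg, rfl⟩, depth_zpowers_pow hinj hg hr⟩
  · rintro ⟨n, hn, rfl⟩
    obtain ⟨g, hg, rfl⟩ := (mem_depthProfile_zpowers hG hv _).1 hn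
    refine ⟨g, ?_, (depth_zpowers_pow hinj hg hr).symm⟩
    rwa [hmod, hmod]

theorem depth_map {H : Type v} [Group H] {φ : G →* H} (hφ : Function.Injective φ) (v g : G) :
    depth (Subgroup.zpowers (φ v)) (φ g) = depth (Subgroup.zpowers v) g := by
  refine depth_eq_of_forall fun i => ?_
  rw [depth_dvd_iff, ← map_inv, ← map_zpow, ← map_mul, ← map_mul, ← MonoidHom.map_zpowers,
    Subgroup.mem_map_iff_mem hφ]

theorem depthProfile_mulEquiv {H : Type v} [Group H] (φ : G ≃* H) (hG : IsNonelementaryGBS G)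
    (hH : IsNonelementaryGBS H) {v : G} (hv : IsCommensuratedElement v) :
    depthProfile (Subgroup.zpowers (φ v)) = depthProfile (Subgroup.zpowers v) := by
  have hinj : Function.Injective φ.toMonoidHom := φ.injective
  ext d
  rw [mem_depthProfile_zpowers hG hv, mem_depthProfile_zpowers hH (hv.map φ)]
  constructor
  · rintro ⟨g, hg, rfl⟩
    obtain ⟨g, rfl⟩ := φ.surjective g
    exact ⟨g, hg.imp (IsModulus.of_map (φ := φ.toMonoidHom) hinj)
      (IsModulus.of_map (φ := φ.toMonoidHom) hinj), depth_map hinj v g⟩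
  · rintro ⟨g, hg, rfl⟩
    exact ⟨φ g, hg.imp (fun h => h.map φ.toMonoidHom) (fun h => h.map φ.toMonoidHom),
      (depth_map hinj v g).symm⟩

end Depth

/-! ### Restriction to subgroups of finite index -/

section Restriction

variable {G : Type u} [Group G]

theorem Subgroup.nonempty_subgroupOf_mulEquiv_int {A : Subgroup G} (G' : Subgroup G)
    [G'.FiniteIndex] (h : Nonempty (A ≃* Multiplicative ℤ)) :
    Nonempty (A.subgroupOf G' ≃* Multiplicative ℤ) := by
  obtain ⟨e⟩ := h
  set c : A := e.symm (Multiplicative.ofAdd 1) with hc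
  have hpow : ∀ i : ℤ, e (c ^ i) = Multiplicative.ofAdd i := by
    intro i
    rw [map_zpow, hc, e.apply_symm_apply]
    apply Multiplicative.toAdd.injective
    simp
  have hinj : Function.Injective (fun k : ℤ => (c : G) ^ k) := by
    intro k l hkl
    have h1 : c ^ k = c ^ l := Subtype.ext (by simpa using hkl)
    have h2 := congrArg e h1
    rw [hpow, hpow] at h2
    exact h2
  have hsurj : ∀ a ∈ A, ∃ i : ℤ, a = (c : G) ^ i := by
    intro a ha
    refine ⟨(e ⟨a, ha⟩).toAdd, ?_⟩
    have h1 : (⟨a, ha⟩ : A) = c ^ (e ⟨a, ha⟩).toAdd := e.injective (by rw [hpow]; rfl)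
    simpa using congrArg Subtype.val h1
  set N := G'.relIndex (Subgroup.zpowers (c : G)) with hN
  have hN0 : (N : ℤ) ≠ 0 := by
    have : N ≠ 0 :=
      Subgroup.FiniteIndex.index_ne_zero (H := G'.subgroupOf (Subgroup.zpowers (c : G)))
    omega
  have hbG : (c : G) ^ (N : ℤ) ∈ G' := (G'.zpow_mem_iff_relIndex_dvd _ _).2 dvd_rfl
  let b : A.subgroupOf G' := ⟨⟨(c : G) ^ (N : ℤ), hbG⟩, A.zpow_mem c.2 _⟩
  have hb : ∀ k : ℤ, ((b ^ k : A.subgroupOf G') : G') = (⟨(c : G) ^ (N * k), by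
      rw [zpow_mul]; exact G'.zpow_mem hbG k⟩ : G') := by
    intro k
    apply Subtype.ext
    simp [b, zpow_mul]
  refine ⟨(MulEquiv.ofBijective (zpowersHom (A.subgroupOf G') b) ⟨?_, ?_⟩).symm⟩
  · intro k l hkl
    have h1 : b ^ (k.toAdd) = b ^ (l.toAdd) := by simpa [zpowersHom_apply] using hkl
    have h2 := congrArg (fun z : A.subgroupOf G' => ((z : G') : G)) h1
    simp only [hb] at h2
    exact Multiplicative.toAdd.injective (mul_left_cancel₀ hN0 (hinj h2))
  · rintro ⟨⟨a, haG⟩, haA⟩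
    obtain ⟨i, rfl⟩ := hsurj a haA
    obtain ⟨k, rfl⟩ := (G'.zpow_mem_iff_relIndex_dvd _ _).1 haG
    refine ⟨Multiplicative.ofAdd k, ?_⟩
    rw [zpowersHom_apply]
    exact Subtype.ext (hb k)

/-- A GBS tree for `G`, regarded as a GBS tree for a subgroup of finite index. -/
def GBSTree.restrict (X : GBSTree G) (G' : Subgroup G) [G'.FiniteIndex] : GBSTree G' where
  Vert := X.Vert
  graph := X.graph
  isTree := X.isTree
  act := MulAction.compHom X.Vert G'.subtype
  adj_smul g x y h := X.adj_smul (g : G) x y h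
  no_inversion g x y h := X.no_inversion (g : G) x y h
  vertex_stabilizer x :=
    Subgroup.nonempty_subgroupOf_mulEquiv_int G' (X.vertex_stabilizer x)
  edge_stabilizer x y h :=
    Subgroup.nonempty_subgroupOf_mulEquiv_int G' (X.edge_stabilizer x y h)

/-- A vertex fixed by a subgroup of finite index has a finite orbit. -/
theorem GBSTree.isElementary_of_restrict_fixed (X : GBSTree G) (G' : Subgroup G) [G'.FiniteIndex]
    {x : X.Vert} (hx : ∀ g ∈ G', g • x = x) : X.IsElementary := by
  left
  refine X.exists_fixed_of_finite_orbit (x := x) ?_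
  have h1 : G' ≤ MulAction.stabilizer G x := fun g hg => hx g hg
  have h2 : (MulAction.stabilizer G x).FiniteIndex := Subgroup.finiteIndex_of_le h1
  have h3 : Finite (MulAction.orbit G x) :=
    Finite.of_equiv _ (MulAction.orbitEquivQuotientStabilizer G x).symm
  exact Set.toFinite _

theorem GBSTree.isElementary_of_restrict_line (X : GBSTree G) (G' : Subgroup G) [G'.FiniteIndex]
    {l : ℤ → X.Vert} (hline : X.graph.IsGeodesicLine l)
    (hl' : ∀ g ∈ G', ∀ i, g • l i ∈ Set.range l) : X.IsElementary := by
  by_cases hyp : ∃ g : G, ∀ x : X.Vert, g • x ≠ x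
  · -- The invariant line is the axis of every element without fixed vertex, hence `G`-invariant.
    obtain ⟨h, hh⟩ := hyp
    have key : ∀ h : G, (∀ x : X.Vert, h • x ≠ x) → ∀ (a : ℤ → X.Vert) (n : ℤ),
        X.graph.IsGeodesicLine a → n ≠ 0 → (∀ i, h • a i = a (i + n)) →
        Set.range a = Set.range l := by
      intro h hh a n ha hn htr
      obtain ⟨k, hk, -, hkG⟩ := G'.exists_pow_mem_of_index_ne_zero G'.index_ne_zero_of_finite h
      have hka : ∀ i, h ^ k • a i = a (i + k * n) := fun i => by
        rw [← zpow_natCast]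
        exact X.zpow_smul_line htr k i
      have hkn : (k : ℤ) * n ≠ 0 := mul_ne_zero (by omega) hn
      have hnofix := X.smul_ne_of_translates ha hkn hka
      obtain ⟨t, ht | ht⟩ := X.translates_or_reflects hline (hl' _ hkG)
      · have ht0 : t ≠ 0 := by
          rintro rfl
          exact hnofix (l 0) (by simpa using ht 0)
        exact (X.range_subset_of_translates hline ha hkn ht hka).antisymm
          (X.range_subset_of_translates ha hline ht0 hka ht)
      · -- The square of a reflection fixes the line pointwise.
        have hk2 : ∀ i, (h ^ k * h ^ k) • a i = a (i + (k * n + k * n)) := fun i => by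
          rw [mul_smul, hka, hka, add_assoc]
        refine absurd ?_ (X.smul_ne_of_translates ha (by omega) hk2 (l 0))
        rw [mul_smul, ht, ht]
        simp
    obtain ⟨a, n, ha, hn, htr⟩ := X.exists_axis hh
    have hal := key h hh a n ha hn htr
    refine X.isElementary_of_line hline fun g i => ?_
    have hconj : ∀ x : X.Vert, (g * h * g⁻¹) • x ≠ x := by
      intro x hx
      apply hh (g⁻¹ • x)
      rw [mul_smul, mul_smul] at hx
      rw [← inv_smul_smul g (h • g⁻¹ • x), hx]
    have hgl := key _ hconj (fun i => g • a i) n (X.smul_line ha g) hn (fun i => by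
      rw [mul_smul, mul_smul, inv_smul_smul, htr])
    obtain ⟨j, hj⟩ : l i ∈ Set.range a := hal ▸ ⟨i, rfl⟩
    rw [← hgl, ← hj]
    exact ⟨j, rfl⟩
  · -- If every element has a fixed vertex, at most one reflection of the line can occur.
    push Not at hyp
    have hrefl : ∀ g ∈ G', (∀ i, g • l i = l i) ∨ ∃ t, ∀ i, g • l i = l (t - i) := by
      intro g hg
      obtain ⟨t, ht | ht⟩ := X.translates_or_reflects hline (hl' g hg)
      · left
        obtain ⟨y, hy⟩ := hyp g
        have ht0 : t = 0 := by
          by_contra h0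
          exact X.smul_ne_of_translates hline h0 ht y hy
        simpa [ht0] using ht
      · exact Or.inr ⟨t, ht⟩
    have hfin : (MulAction.orbit G' (α := (X.restrict G').Vert) (l 0)).Finite := by
      by_cases hex : ∃ g ∈ G', ∃ t, ∀ i, g • l i = l (t - i)
      · obtain ⟨g, hg, t, ht⟩ := hex
        refine (Set.toFinite {l 0, l t}).subset ?_
        rintro _ ⟨⟨h, hh⟩, rfl⟩
        change h • l 0 ∈ _
        rcases hrefl h hh with h1 | ⟨s, hs⟩
        · exact Or.inl (h1 0)
        · right
          have hprod : ∀ i, (g * h) • l i = l (i + (t - s)) := fun i => by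
            rw [mul_smul, hs, ht]
            congr 1
            ring
          obtain ⟨y, hy⟩ := hyp (g * h)
          have hts : t - s = 0 := by
            by_contra h0
            exact X.smul_ne_of_translates hline h0 hprod y hy
          rw [hs, sub_zero, show s = t by omega]
          rfl
      · refine (Set.toFinite {l 0}).subset ?_
        rintro _ ⟨⟨h, hh⟩, rfl⟩
        rcases hrefl h hh with h1 | h1
        · exact h1 0
        · exact absurd ⟨h, hh, h1⟩ hex
    obtain ⟨y, hy⟩ := (X.restrict G').exists_fixed_of_finite_orbit hfin
    exact X.isElementary_of_restrict_fixed G' (x := y) fun g hg => hy ⟨g, hg⟩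

theorem GBSTree.isElementary_of_restrict (X : GBSTree G) (G' : Subgroup G) [G'.FiniteIndex]
    (h : (X.restrict G').IsElementary) : X.IsElementary := by
  rcases h with ⟨x, hx⟩ | ⟨l, hinj, hadj, hl⟩
  · exact X.isElementary_of_restrict_fixed G' (x := x) fun g hg => hx ⟨g, hg⟩
  · exact X.isElementary_of_restrict_line G' (X.isGeodesicLine_of_injective hinj hadj)
      fun g hg i => hl ⟨g, hg⟩ i

theorem IsNonelementaryGBS.subgroup (hG : IsNonelementaryGBS G) (G' : Subgroup G)
    [G'.FiniteIndex] : IsNonelementaryGBS G' := by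
  obtain ⟨X, hX⟩ := hG
  exact ⟨X.restrict G', fun h => hX (X.isElementary_of_restrict G' h)⟩

end Restriction

/-! ### Realizing depths in subgroups of finite index -/

section PingPong

variable {G : Type u} [Group G] (X : GBSTree G)

/-- Ping-pong on the two sides of the vertex `p`, which is the vertex fixed by `c'` nearest to the
vertex `x` fixed by `c`. -/
theorem GBSTree.distBetween_pow_smul {c c' : G} {x p : X.Vert} (hc : c • x = x)
    (hp : c' • p = p) (hmin : ∀ z : X.Vert, c' • z = z → X.graph.dist x p ≤ X.graph.dist x z)
    (hcp : c • p ≠ p) {n : ℕ} (hn : 0 < n) : X.graph.DistBetween x p ((c' * c) ^ n • x) := by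
  have hout : ∀ z, ¬ X.graph.DistBetween x p z → X.graph.DistBetween x p (c' • z) := by
    intro z hz
    by_contra hz'
    obtain ⟨q, hq, hqx, hqz⟩ := X.isTree.exists_common_closer_adj hz
    obtain ⟨q', hq', hqx', hqz'⟩ := X.isTree.exists_common_closer_adj hz'
    obtain rfl := X.isTree.closer_adj_unique hq hq' hqx hqx'
    have h1 : X.graph.Adj p (c' • q) := by
      have h2 := X.adj_smul c' _ _ hq
      rwa [hp] at h2
    have h2 : X.graph.dist (c' • z) (c' • q) + 1 = X.graph.dist (c' • z) p := by
      rw [X.dist_smul, hqz, ← X.dist_smul c', hp]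
    have h3 := X.isTree.closer_adj_unique h1 hq h2 hqz'
    have h4 := hmin q h3
    omega
  have hin : ∀ z, X.graph.DistBetween x p z → ¬ X.graph.DistBetween x p (c • z) := by
    intro z hz hz'
    apply hcp
    have h1 : X.graph.dist x (c • p) = X.graph.dist x p := by
      conv_lhs => rw [← hc]
      exact X.dist_smul _ _ _
    have h2 : X.graph.dist x (c • z) = X.graph.dist x z := by
      conv_lhs => rw [← hc]
      exact X.dist_smul _ _ _
    refine X.isTree.eq_of_distBetween ?_ hz' h1
    unfold SimpleGraph.DistBetween at *
    rw [h1, h2, X.dist_smul, hz]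
  have hxp : ¬ X.graph.DistBetween x p x := by
    intro h
    unfold SimpleGraph.DistBetween at h
    rw [SimpleGraph.dist_self] at h
    have h1 : x = p := X.isTree.connected.dist_eq_zero_iff.1 (by omega)
    exact hcp (h1 ▸ hc)
  induction n, hn using Nat.le_induction with
  | base =>
    rw [pow_one, mul_smul, hc]
    exact hout _ hxp
  | succ n _ ih =>
    rw [pow_succ', mul_smul, mul_smul]
    exact hout _ (hin _ ih)

/-- If `c ^ K = c' ^ (ε * K)` for some `K ≠ 0`, then the same relation holds for every power of `c`
which has a common fixed vertex with `c'`, because vertex stabilizers are infinite cyclic. -/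
theorem GBSTree.zpow_eq_of_common_fixed {c c' : G} {p : X.Vert} {K ε i : ℤ} (hK : K ≠ 0)
    (hpow : c ^ K = c' ^ (ε * K)) (hc' : c' ≠ 1) (hp : c' • p = p) (hi : c ^ i • p = p) :
    c ^ i = c' ^ (ε * i) := by
  obtain ⟨d, hd, hgen⟩ := X.exists_generator p
  obtain ⟨a, ha⟩ := hgen _ hi
  obtain ⟨b, rfl⟩ := hgen _ hp
  have hd1 : d ≠ 1 := by
    rintro rfl
    exact hc' (one_zpow b)
  have h1 : d ^ (a * K) = d ^ (b * (ε * i) * K) := by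
    rw [zpow_mul, ← ha, ← zpow_mul, mul_comm i, zpow_mul, hpow, ← zpow_mul, ← zpow_mul]
    congr 1
    ring
  have h2 : a = b * (ε * i) := mul_right_cancel₀ hK (X.zpow_injective hd hd1 h1)
  rw [ha, h2, zpow_mul]

/-- Every depth realized by an element of modulus `±1` is realized in a given subgroup of finite
index. If `c` generates the stabilizer of `x` and `c' = g c g⁻¹`, then suitable powers of `c' * c`
have the same depth as `g`: by ping-pong, an element fixing `x` and its image under such a power
also fixes a vertex fixed by `c'`, and therefore fixes `g • x`. -/
theorem GBSTree.exists_mem_depth_eq {x : X.Vert} {c : G} (hc : c • x = x)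
    (hgen : ∀ a : G, a • x = x → ∃ i : ℤ, a = c ^ i) (hc1 : c ≠ 1) (G' : Subgroup G)
    [G'.FiniteIndex] {g : G} (hg : IsModulus c g 1 ∨ IsModulus c g (-1)) :
    ∃ h ∈ G', IsModulus c h 1 ∧
      depth (Subgroup.zpowers c) h = depth (Subgroup.zpowers c) g := by
  classical
  have hpos : 0 < depth (Subgroup.zpowers c) g :=
    hg.elim depth_pos_of_isModulus depth_pos_of_isModulus
  obtain ⟨ε, -, hε⟩ := conj_zpow_depth (X.zpow_injective hc hc1) hg
  set K := depth (Subgroup.zpowers c) g with hK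
  have hK0 : (K : ℤ) ≠ 0 := by omega
  by_cases hK1 : K = 1
  · refine ⟨1, G'.one_mem, IsModulus.one c, ?_⟩
    rw [hK1]
    refine depth_eq_of_forall fun i => ?_
    simp
  have hmem : ∀ (h : G) (i : ℤ), c ^ i • h • x = h • x → h⁻¹ * c ^ i * h ∈ Subgroup.zpowers c := by
    intro h i hi
    obtain ⟨j, hj⟩ := hgen (h⁻¹ * c ^ i * h) (by rw [mul_smul, mul_smul, hi, inv_smul_smul])
    exact ⟨j, hj.symm⟩
  set c' := g * c * g⁻¹ with hc'
  have hc'1 : c' ≠ 1 := by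
    rw [hc', Ne, conj_eq_one_iff]
    exact hc1
  have hc'g : c' • g • x = g • x := by
    rw [hc', mul_smul, mul_smul, inv_smul_smul, hc]
  have hpow : c ^ (K : ℤ) = c' ^ (ε * K) := by
    rw [hc', conj_zpow, ← hε]
    group
  have hdvd : ∀ (p : X.Vert) (i : ℤ), c' • p = p → c ^ i • p = p → (K : ℤ) ∣ i := by
    intro p i hp hi
    rw [hK, depth_dvd_iff]
    apply hmem
    rw [X.zpow_eq_of_common_fixed hK0 hpow hc'1 hp hi]
    exact (MulAction.stabilizer G (g • x)).zpow_mem (x := c') hc'g _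
  obtain ⟨p, hp, hmin⟩ : ∃ p : X.Vert, c' • p = p ∧
      ∀ z : X.Vert, c' • z = z → X.graph.dist x p ≤ X.graph.dist x z := by
    have hex : ∃ n, ∃ p : X.Vert, c' • p = p ∧ X.graph.dist x p = n := ⟨_, g • x, hc'g, rfl⟩
    obtain ⟨p, hp, hd⟩ := Nat.find_spec hex
    exact ⟨p, hp, fun z hz => hd ▸ Nat.find_min' hex ⟨z, hz, rfl⟩⟩
  have hcp : c • p ≠ p := by
    intro h
    have h1 := hdvd p 1 hp (by rwa [zpow_one])
    exact hK1 (by exact_mod_cast Int.eq_one_of_dvd_one (by omega) h1)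
  obtain ⟨n, hn, -, hnG⟩ :=
    G'.exists_pow_mem_of_index_ne_zero Subgroup.FiniteIndex.index_ne_zero (c' * c)
  have hbetween := X.distBetween_pow_smul hc hp hmin hcp hn
  have hcomm : Commute (c ^ (K : ℤ)) ((c' * c) ^ n) := by
    refine Commute.pow_right (Commute.mul_right ?_ ((Commute.refl c).zpow_left _)) n
    rw [hpow]
    exact (Commute.refl c').zpow_left _
  set h := (c' * c) ^ n with hh
  have hconj : h⁻¹ * c ^ (K : ℤ) * h = c ^ (K : ℤ) := by
    rw [mul_assoc, hcomm.eq, inv_mul_cancel_left]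
  refine ⟨h, hnG, ⟨K, K, hK0, hK0, hconj, ?_⟩, depth_eq_of_forall fun i => ⟨fun hi => ?_, ?_⟩⟩
  · rw [div_self (by exact_mod_cast hK0)]
  · obtain ⟨j, hj⟩ := hi
    have hix : c ^ i • x = x := (MulAction.stabilizer G x).zpow_mem (x := c) hc _
    have hih : c ^ i • h • x = h • x := by
      have h1 : c ^ i * h = h * c ^ j := by
        rw [show c ^ j = h⁻¹ * c ^ i * h from hj]
        group
      rw [← mul_smul, h1, mul_smul, (MulAction.stabilizer G x).zpow_mem (x := c) hc j]
    exact hdvd p i hp (X.smul_eq_of_distBetween hix hih hbetween)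
  · rintro ⟨s, rfl⟩
    rw [zpow_mul, ← conj_zpow_aux, hconj, ← zpow_mul]
    exact ⟨_, rfl⟩

end PingPong

/-! ### Depth profiles under passage to finite index and commensurability -/

section Profile

variable {G : Type u} [Group G]

theorem Subgroup.eq_zpowers_pow_of_le {V' : Subgroup G} {v : G}
    (h : V' ≤ Subgroup.zpowers v) :
    V' = Subgroup.zpowers (v ^ V'.relIndex (Subgroup.zpowers v)) := by
  apply le_antisymm
  · intro a ha
    obtain ⟨i, rfl⟩ := h ha
    obtain ⟨k, rfl⟩ := (V'.zpow_mem_iff_relIndex_dvd v i).1 ha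
    exact ⟨k, by simp only [zpow_mul, zpow_natCast]⟩
  · rw [Subgroup.zpowers_le, ← zpow_natCast]
    exact (V'.zpow_mem_iff_relIndex_dvd v _).2 dvd_rfl

/-- A non-trivial elliptic subgroup is generated by a single elliptic element. -/
theorem IsEllipticSubgroup.exists_zpowers_eq {V : Subgroup G} (hV : IsEllipticSubgroup V)
    (hV1 : V ≠ ⊥) : ∃ v : G, IsCommensuratedElement v ∧ V = Subgroup.zpowers v := by
  obtain ⟨X, x, hx⟩ := hV
  obtain ⟨c, hc, hgen⟩ := X.exists_generator x
  set N := V.relIndex (Subgroup.zpowers c) with hN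
  have hVN : V = Subgroup.zpowers (c ^ N) :=
    Subgroup.eq_zpowers_pow_of_le fun a ha => by
      obtain ⟨i, hi⟩ := hgen a (hx a ha)
      exact ⟨i, hi.symm⟩
  refine ⟨c ^ N, IsElliptic.isCommensuratedElement ⟨X, x, ?_⟩ ?_, hVN⟩
  · exact (MulAction.stabilizer G x).pow_mem (x := c) hc N
  · intro h
    rw [h, Subgroup.zpowers_one_eq_bot] at hVN
    exact hV1 hVN

theorem Subgroup.zpowers_zpow_eq (v : G) (k : ℤ) :
    Subgroup.zpowers (v ^ k) = Subgroup.zpowers (v ^ k.natAbs) := by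
  rcases Int.natAbs_eq k with h | h
  · conv_lhs => rw [h, zpow_natCast]
  · conv_lhs => rw [h, zpow_neg, zpow_natCast, Subgroup.zpowers_inv]

theorem depthProfile_zpowers_zpow {v : G} (hG : IsNonelementaryGBS G)
    (hv : IsCommensuratedElement v) {k : ℤ} (hk : k ≠ 0) :
    depthProfile (Subgroup.zpowers (v ^ k)) =
      truncDiv (depthProfile (Subgroup.zpowers v)) k.natAbs := by
  rw [Subgroup.zpowers_zpow_eq, depthProfile_zpowers_pow hG hv (Int.natAbs_pos.2 hk)]

theorem depthEquiv_zpow {v : G} (hG : IsNonelementaryGBS G) (hv : IsCommensuratedElement v) {k : ℤ}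
    (hk : k ≠ 0) :
    DepthEquiv (depthProfile (Subgroup.zpowers v)) (depthProfile (Subgroup.zpowers (v ^ k))) :=
  Relation.EqvGen.rel _ _ ⟨k.natAbs, Int.natAbs_pos.2 hk, depthProfile_zpowers_zpow hG hv hk⟩

theorem depthProfile_subgroup {v : G} (hG : IsNonelementaryGBS G) (hv : IsCommensuratedElement v)
    (G' : Subgroup G) [G'.FiniteIndex] (hvG : v ∈ G') :
    depthProfile (Subgroup.zpowers (⟨v, hvG⟩ : G')) = depthProfile (Subgroup.zpowers v) := by
  set w : G' := ⟨v, hvG⟩ with hw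
  have hinj : Function.Injective G'.subtype := G'.subtype_injective
  have hwc : IsCommensuratedElement w := IsCommensuratedElement.subgroup hv
  have hdepth : ∀ g : G', depth (Subgroup.zpowers v) (g : G) = depth (Subgroup.zpowers w) g :=
    fun g => depth_map hinj w g
  ext d
  rw [mem_depthProfile_zpowers hG hv, mem_depthProfile_zpowers (hG.subgroup G') hwc]
  constructor
  · rintro ⟨g, hg, rfl⟩
    exact ⟨g, hg.imp (fun h => h.map G'.subtype) (fun h => h.map G'.subtype), (hdepth g).symm⟩
  · rintro ⟨g, hg, rfl⟩
    obtain ⟨X, hX⟩ := hG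
    obtain ⟨x, hx⟩ := X.exists_smul_eq_of_commensurated hX hv
    obtain ⟨c, hc, hgen⟩ := X.exists_generator x
    obtain ⟨i, hi⟩ := hgen v hx
    have hi0 : i ≠ 0 := by
      rintro rfl
      exact hv.1 (by simpa using hi)
    have hc1 : c ≠ 1 := by
      rintro rfl
      exact hv.1 (by simpa using hi)
    have hcinj := X.zpow_injective hc hc1
    have hcg : IsModulus c g 1 ∨ IsModulus c g (-1) := by
      rwa [hi, isModulus_zpow_iff hi0, isModulus_zpow_iff hi0] at hg
    obtain ⟨h, hhG, hh, hd⟩ := X.exists_mem_depth_eq hc hgen hc1 G' hcg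
    refine ⟨⟨h, hhG⟩, Or.inl (IsModulus.of_map (φ := G'.subtype) hinj ?_), ?_⟩
    · change IsModulus v h 1
      rw [hi]
      exact hh.zpow i
    · rw [← hdepth, hi, Subgroup.zpowers_zpow_eq,
        depth_zpowers_pow hcinj hcg (Int.natAbs_pos.2 hi0),
        depth_zpowers_pow hcinj (Or.inl hh) (Int.natAbs_pos.2 hi0), hd]

theorem exists_zpow_mem_of_finiteIndex (G' : Subgroup G) [G'.FiniteIndex] (v : G) :
    ∃ k : ℤ, k ≠ 0 ∧ v ^ k ∈ G' := by
  obtain ⟨k, hk, -, hkG⟩ :=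
    G'.exists_pow_mem_of_index_ne_zero Subgroup.FiniteIndex.index_ne_zero v
  exact ⟨k, by omega, by rwa [zpow_natCast]⟩

/-- Up to equivalence, the depth profile can be computed in a subgroup of finite index, with any
non-trivial elliptic element of that subgroup. -/
theorem depthEquiv_subgroup {v : G} (hG : IsNonelementaryGBS G) (hv : IsCommensuratedElement v)
    (G' : Subgroup G) [G'.FiniteIndex] {w : G'} (hw : IsCommensuratedElement w) :
    DepthEquiv (depthProfile (Subgroup.zpowers v)) (depthProfile (Subgroup.zpowers w)) := by
  obtain ⟨k, hk, hkG⟩ := exists_zpow_mem_of_finiteIndex G' v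
  have hG' := hG.subgroup G'
  have hvk := hv.zpow hG hk
  have hvk' : IsCommensuratedElement (⟨v ^ k, hkG⟩ : G') := IsCommensuratedElement.subgroup hvk
  obtain ⟨m, n, hm, hn, e⟩ := hvk'.exists_zpow_eq hG' hw
  refine (depthEquiv_zpow hG hv hk).trans _ _ _ ?_
  rw [← depthProfile_subgroup hG hvk G' hkG]
  refine (depthEquiv_zpow hG' hvk' hm).trans _ _ _ ?_
  rw [e]
  exact (depthEquiv_zpow hG' hw hn).symm _ _

theorem depthEquiv_of_commensurable {H : Type v} [Group H] (hG : IsNonelementaryGBS G)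
    (hH : IsNonelementaryGBS H) {v : G} {w : H} (hv : IsCommensuratedElement v)
    (hw : IsCommensuratedElement w) (h : AbstractlyCommensurable G H) :
    DepthEquiv (depthProfile (Subgroup.zpowers v)) (depthProfile (Subgroup.zpowers w)) := by
  obtain ⟨G', H', hfG, hfH, ⟨φ⟩⟩ := h
  obtain ⟨k, hk, hkG⟩ := exists_zpow_mem_of_finiteIndex G' v
  have hvk : IsCommensuratedElement (⟨v ^ k, hkG⟩ : G') :=
    IsCommensuratedElement.subgroup (hv.zpow hG hk)
  refine (depthEquiv_subgroup hG hv G' hvk).trans _ _ _ ?_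
  rw [← depthProfile_mulEquiv φ (hG.subgroup G') (hH.subgroup H') hvk]
  exact (depthEquiv_subgroup hH hw H' (hvk.map φ)).symm _ _

end Profile

theorem mainTheorem5 (G : Type u) [Group G] (hG : IsNonelementaryGBS G)
    (V : Subgroup G) (hV : IsEllipticSubgroup V) (hV1 : V ≠ ⊥) :
    (∀ g : G, 0 < depth V g) ∧
    (∀ G' : Subgroup G, G'.FiniteIndex → V ≤ G' →
      IsNonelementaryGBS G' ∧ IsEllipticSubgroup (V.subgroupOf G') ∧
      depthProfile V = depthProfile (V.subgroupOf G')) ∧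
    (∀ (V' : Subgroup G) (r : ℕ), V' ≤ V → 0 < r → V'.relIndex V = r →
      depthProfile V' = {k | ∃ n ∈ depthProfile V, k = n / Nat.gcd r n}) ∧
    (∀ (H : Type v) [Group H], IsNonelementaryGBS H →
      ∀ W : Subgroup H, IsEllipticSubgroup W → W ≠ ⊥ →
      AbstractlyCommensurable G H → DepthEquiv (depthProfile V) (depthProfile W)) := by
  obtain ⟨X, x, hx⟩ := id hV
  obtain ⟨v, hv, rfl⟩ := hV.exists_zpowers_eq hV1
  refine ⟨fun g => ?_, fun G' hfin hle => ⟨hG.subgroup G', ?_, ?_⟩, fun V' r hle hr hidx => ?_,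
    fun H _ hH W hW hW1 hcomm => ?_⟩
  · obtain ⟨t, ht⟩ := hv.2 g
    exact depth_pos_of_isModulus ht
  · exact ⟨X.restrict G', x, fun g hg => hx g hg⟩
  · have hvG : v ∈ G' := hle (Subgroup.mem_zpowers v)
    have hsub : (Subgroup.zpowers v).subgroupOf G' = Subgroup.zpowers (⟨v, hvG⟩ : G') := by
      apply Subgroup.map_injective G'.subtype_injective
      rw [Subgroup.subgroupOf_map_subtype, inf_of_le_left hle, MonoidHom.map_zpowers]
      rfl
    rw [hsub, depthProfile_subgroup hG hv G' hvG]
  · rw [Subgroup.eq_zpowers_pow_of_le hle, hidx]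
    exact depthProfile_zpowers_pow hG hv hr
  · obtain ⟨w, hw, rfl⟩ := hW.exists_zpowers_eq hW1
    exact depthEquiv_of_commensurable hG hH hv hw hcomm
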